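/- Let $p$ be a prime. For integers $j,n\ge 0$ let $\vartheta_p(j,n)=\bigl|\{t\in\{0,\dots,n\}: \nu_p\binom nt=j\}\bigr|$, where $\nu_p$ is the $p$-adic valuation. Let $W$ be the set of all words $w=w_{\mu-1}\cdots w_0$ over the digits $\{0,\dots,p-1\}$ with $\mu\ge 2$, $w_{\mu-1}\ne 0$ and $w_0\ne p-1$. For $w\in W$ and $n\ge0$ with base-$p$ expansion $n=\sum_{i\ge 0}n_ip^i$, let $|n|_w=\bigl|\{i\ge 0: n_{i+\mu-1}\cdots n_i=w_{\mu-1}\cdots w_0\}\bigr|$ be the number of (possibly overlapping) occurrences of $w$ in the base-$p$ expansion of $n$, padded with leading zeros. For every $j\ge 0$ there is a unique polynomial $P_j$ with rational coefficients in the variables $X_w$, $w\in W$, such that \[ \frac{\vartheta_p(j,n)}{\vartheta_p(0,n)}=P_j\bigl((|n|_w)_{w\in W}\bigr)\qquad\text{for all } n\ge 0 . \] Every monomial $X_{w^{(1)}}^{k_1}\cdots X_{w^{(\ell)}}^{k_\ell}$ in these variables other than the constant monomial $1$ occurs with nonzero coefficient in infinitely many of the polynomials $P_j$, $j\ge 0$.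 -/

import Mathlib

/-- `vartheta p j n` is the number of `t ∈ {0, …, n}` such that `p ^ j` exactly divides
the binomial coefficient `n.choose t`. -/
def vartheta (p j n : ℕ) : ℕ :=
  ((Finset.range (n + 1)).filter (fun t => padicValNat p (n.choose t) = j)).card

/-- A word `w_{μ-1} ⋯ w_0` over the digits `{0, …, p - 1}` is encoded as the list
`[w_0, …, w_{μ-1}]` of length `μ`, so that the entry with index `i` is `w_i`.
It is admissible if `μ ≥ 2`, `w_{μ-1} ≠ 0` and `w_0 ≠ p - 1`. -/
def IsAdmissible (p : ℕ) (w : List ℕ) : Prop :=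
  2 ≤ w.length ∧ (∀ d ∈ w, d < p) ∧ w.getD (w.length - 1) 0 ≠ 0 ∧ w.getD 0 0 ≠ p - 1

/-- The set `W` of admissible words. -/
def AdmissibleWord (p : ℕ) : Type := {w : List ℕ // IsAdmissible p w}

/-- The positions `i ≥ 0` at which `w` occurs as a factor of the base-`p` expansion of `n`
(padded with zeros on the left): `n_{i+μ-1} ⋯ n_i = w_{μ-1} ⋯ w_0`, where
`n_i = n / p ^ i % p` is the `i`-th digit of `n`. -/
def factorPositions (p n : ℕ) (w : List ℕ) : Set ℕ :=
  {i | ∀ k < w.length, n / p ^ (i + k) % p = w.getD k 0}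

/-- The number `|n|_w` of (possibly overlapping) occurrences of `w` in the base-`p`
expansion of `n`. -/
noncomputable def factorCount (p n : ℕ) (w : List ℕ) : ℕ := (factorPositions p n w).ncard

/-- An admissible word occurs only finitely often, so `factorCount` is a true count. -/
theorem factorPositions_finite {p : ℕ} (hp : p.Prime) (n : ℕ) {w : List ℕ}
    (hw : IsAdmissible p w) : (factorPositions p n w).Finite := by
  refine (Set.finite_Iio n).subset fun i hi => ?_
  by_contra hin
  have hin : n ≤ i := not_lt.mp hin
  have h := hi (w.length - 1) (by have := hw.1; omega)
  have hlt : n < p ^ (i + (w.length - 1)) :=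
    lt_of_le_of_lt (hin.trans (Nat.le_add_right _ _)) (Nat.lt_pow_self hp.one_lt)
  rw [Nat.div_eq_of_lt hlt, Nat.zero_mod] at h
  exact hw.2.2.1 h.symm

/-- `Q`, a polynomial with rational coefficients in variables `X_w` indexed by the admissible
words `w`, represents the function `n ↦ vartheta p j n / vartheta p 0 n` when each variable
`X_w` is set to `|n|_w`. -/
def RepresentsRatio (p j : ℕ) (Q : MvPolynomial (AdmissibleWord p) ℚ) : Prop :=
  ∀ n : ℕ, MvPolynomial.eval (fun w : AdmissibleWord p => (factorCount p n w.1 : ℚ)) Q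
    = (vartheta p j n : ℚ) / (vartheta p 0 n : ℚ)

/-! Let `T_n(x) = Σ_j vartheta p j n * x^j` (`carryPoly`), and let `U_n` (`carryPolyIn`) be its
analogue with an incoming carry. Appending a digit to `n` acts on `(T_n, U_n)` by a 2×2 matrix of
determinant `p x`, whatever the digit. Hence for a top digit `a`, a middle block `m` of length `k`
and a last digit `b`, the difference `T_{amb} T_m - T_{am} T_{mb}` is the single monomial `a (p-1-b)
p^k x^(k+1)` (`carryPoly_cross`). So the mixed second difference `log r_n` of `log T_n`, taken by
removing the top and the last digit, is zero exactly when `b = p-1`, and otherwise has order exactly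
`k+1` at `0`.

The same difference applied to `|·|_w` is the indicator of the number spelled by `w`
(`digitDiff_factorCount`). Comparing the two, `T_n / T_n(0) = ∏_w r_w^{|n|_w}`. Thus `P_j` is the
coefficient of `x^j` in `exp(Σ_w X_w log r_w)`, which involves finitely many `w`; the exponential is
built as the solution of a linear differential equation. Uniqueness is the algebraic independence of
the counts (`eq_zero_of_eval_count_eq_zero`).

The coefficients of a fixed monomial, collected over all `j`, form a nonzero multiple of `∏ (log
r_w)^{k_w}`, and this must not be a polynomial. Each `r_w` is a quotient of polynomials that are at
least `1` on `[0, ∞)`, so `log r_w` is analytic there and `O(log x)`. A polynomial equal to the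
product near `0` equals it on `[0, ∞)`, so it is constant by growth and zero by its value at `0`;
but no `log r_w` is zero. -/

/-! ### Carry polynomials, their digit recursion and its determinant -/

section CarryPolynomials

open Polynomial

/-- A sum over `range (p * n + d)`, sorted by residues modulo `p`. -/
theorem sum_range_mul_add_eq {M : Type*} [AddCommMonoid M] (g : ℕ → M) {p d : ℕ} (n : ℕ)
    (hd : d ≤ p) :
    ∑ t ∈ Finset.range (p * n + d), g t =
      ∑ a ∈ Finset.range d, ∑ t ∈ Finset.range (n + 1), g (p * t + a) +
        ∑ a ∈ Finset.Ico d p, ∑ t ∈ Finset.range n, g (p * t + a) := by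
  have key : ∀ n, ∑ t ∈ Finset.range (p * n), g t =
      ∑ a ∈ Finset.range p, ∑ t ∈ Finset.range n, g (p * t + a) := by
    intro n
    induction n with
    | zero => simp
    | succ k ih =>
      simp only [Finset.sum_range_succ, Finset.sum_add_distrib, ← ih, Nat.mul_succ,
        Finset.sum_range_add]
  rw [Finset.sum_range_add, key]
  simp only [Finset.sum_range_succ _ n, Finset.sum_add_distrib]
  rw [← Finset.sum_range_add_sum_Ico _ hd]
  abel

/-- The exponent of `p` in `n ! / (t ! * s !)`. -/
def factorialExponent (p n t s : ℕ) : ℕ :=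
  padicValNat p n.factorial - padicValNat p t.factorial - padicValNat p s.factorial

/-- Makes the truncated subtractions in `factorialExponent` genuine for all `t + s ≤ n`, including
`t + s = n - 1`, which `carryPolyIn` needs. -/
theorem padicValNat_factorial_add_le {p : ℕ} (hp : p.Prime) {n t s : ℕ} (h : t + s ≤ n) :
    padicValNat p t.factorial + padicValNat p s.factorial ≤ padicValNat p n.factorial := by
  have := Fact.mk hp
  rw [← padicValNat.mul (Nat.factorial_ne_zero _) (Nat.factorial_ne_zero _)]
  have h1 : t.factorial * s.factorial ∣ n.factorial :=
    (Nat.factorial_mul_factorial_dvd_factorial_add t s).trans (Nat.factorial_dvd_factorial h)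
  exact (padicValNat_dvd_iff_le (Nat.factorial_ne_zero _)).1 (pow_padicValNat_dvd.trans h1)

theorem factorialExponent_eq_choose {p : ℕ} (hp : p.Prime) {n t : ℕ} (h : t ≤ n) :
    factorialExponent p n t (n - t) = padicValNat p (n.choose t) := by
  have := Fact.mk hp
  have h1 := congrArg (padicValNat p) (Nat.choose_mul_factorial_mul_factorial h)
  rw [padicValNat.mul (mul_ne_zero (Nat.choose_pos h).ne' (Nat.factorial_ne_zero _))
    (Nat.factorial_ne_zero _), padicValNat.mul (Nat.choose_pos h).ne' (Nat.factorial_ne_zero _)]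
    at h1
  unfold factorialExponent
  omega

theorem padicValNat_factorial_digit {p : ℕ} (hp : p.Prime) (m : ℕ) {r : ℕ} (hr : r < p) :
    padicValNat p (p * m + r).factorial = m + padicValNat p m.factorial := by
  have := Fact.mk hp
  rw [padicValNat_factorial_mul_add m hr, padicValNat_factorial_mul, add_comm]

/-- The generating polynomial of `j ↦ vartheta p j n`. -/
noncomputable def carryPoly (p n : ℕ) : ℚ[X] :=
  ∑ t ∈ Finset.range (n + 1), X ^ factorialExponent p n t (n - t)

/-- The analogue of `carryPoly` for additions with an incoming carry. -/
noncomputable def carryPolyIn (p n : ℕ) : ℚ[X] :=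
  ∑ t ∈ Finset.range n, X ^ factorialExponent p n t (n - 1 - t)

theorem coeff_carryPoly {p : ℕ} (hp : p.Prime) (n j : ℕ) :
    (carryPoly p n).coeff j = vartheta p j n := by
  unfold carryPoly vartheta
  rw [finsetSum_coeff, Finset.card_filter, Nat.cast_sum]
  refine Finset.sum_congr rfl fun t ht => ?_
  rw [Finset.mem_range] at ht
  rw [factorialExponent_eq_choose hp (by omega), coeff_X_pow]
  simp [eq_comm]

theorem vartheta_zero_pos (p n : ℕ) : 0 < vartheta p 0 n :=
  Finset.card_pos.2 ⟨0, by simp [em]⟩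

theorem factorialExponent_noCarry {p : ℕ} (hp : p.Prime) {n t s d a b : ℕ} (h : t + s = n)
    (hd : d < p) (ha : a < p) (hb : b < p) :
    factorialExponent p (p * n + d) (p * t + a) (p * s + b) = factorialExponent p n t s := by
  unfold factorialExponent
  rw [padicValNat_factorial_digit hp _ hd, padicValNat_factorial_digit hp _ ha,
    padicValNat_factorial_digit hp _ hb]
  omega

/-- Appending a digit to `m` adds `m` to the valuation of `m !`, so the exponent grows by `n - t -
s`, which is `1` here and `0` without a carry. -/
theorem factorialExponent_carry {p : ℕ} (hp : p.Prime) {n t s d a b : ℕ} (h : t + s + 1 = n)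
    (hd : d < p) (ha : a < p) (hb : b < p) :
    factorialExponent p (p * n + d) (p * t + a) (p * s + b) = factorialExponent p n t s + 1 := by
  have := padicValNat_factorial_add_le hp (show t + s ≤ n by omega)
  unfold factorialExponent
  rw [padicValNat_factorial_digit hp _ hd, padicValNat_factorial_digit hp _ ha,
    padicValNat_factorial_digit hp _ hb]
  omega

/-- Sort `t` by its last digit `a`. If `a ≤ d`, the higher parts add up to `n`; if `a > d`, a carry
leaves the last place, they add up to `n - 1`, and a factor `X` appears. -/
theorem carryPoly_step {p : ℕ} (hp : p.Prime) (n : ℕ) {d : ℕ} (hd : d < p) :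
    carryPoly p (p * n + d) =
      ((d : ℚ[X]) + 1) * carryPoly p n + X * ((p : ℚ[X]) - 1 - (d : ℚ[X])) * carryPolyIn p n := by
  unfold carryPoly carryPolyIn
  rw [add_assoc (p * n), sum_range_mul_add_eq _ n (show d + 1 ≤ p from hd)]
  congr 1
  · rw [Finset.sum_congr rfl (g := fun _ => ∑ t ∈ Finset.range (n + 1),
      X ^ factorialExponent p n t (n - t)), Finset.sum_const, Finset.card_range, nsmul_eq_mul]
    · push_cast; rfl
    · intro a ha
      refine Finset.sum_congr rfl fun t ht => ?_
      rw [Finset.mem_range] at ha ht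
      obtain ⟨s, rfl⟩ := Nat.exists_eq_add_of_le (show t ≤ n by omega)
      rw [show p * (t + s) + d - (p * t + a) = p * s + (d - a) by rw [mul_add]; omega,
        factorialExponent_noCarry hp rfl hd (by omega) (by omega), Nat.add_sub_cancel_left]
  · rw [Finset.sum_congr rfl (g := fun _ => ∑ t ∈ Finset.range n,
      X ^ (factorialExponent p n t (n - 1 - t) + 1)), Finset.sum_const, Nat.card_Ico,
      nsmul_eq_mul]
    · simp only [pow_succ, ← Finset.sum_mul]
      rw [Nat.cast_sub (by omega)]
      push_cast; ring
    · intro a ha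
      refine Finset.sum_congr rfl fun t ht => ?_
      rw [Finset.mem_Ico] at ha
      rw [Finset.mem_range] at ht
      obtain ⟨s, rfl⟩ := Nat.exists_eq_add_of_le (show t + 1 ≤ n by omega)
      rw [show p * (t + 1 + s) + d - (p * t + a) = p * s + (p + d - a) by
          rw [mul_add, mul_add]; omega,
        factorialExponent_carry hp (by omega) hd (by omega) (by omega)]
      congr 3; omega

/-- The incoming carry uses one unit of `d`, so the threshold becomes `a < d`. -/
theorem carryPolyIn_step {p : ℕ} (hp : p.Prime) (n : ℕ) {d : ℕ} (hd : d < p) :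
    carryPolyIn p (p * n + d) =
      (d : ℚ[X]) * carryPoly p n + X * ((p : ℚ[X]) - (d : ℚ[X])) * carryPolyIn p n := by
  unfold carryPoly carryPolyIn
  rw [sum_range_mul_add_eq _ n hd.le]
  congr 1
  · rw [Finset.sum_congr rfl (g := fun _ => ∑ t ∈ Finset.range (n + 1),
      X ^ factorialExponent p n t (n - t)), Finset.sum_const, Finset.card_range, nsmul_eq_mul]
    intro a ha
    refine Finset.sum_congr rfl fun t ht => ?_
    rw [Finset.mem_range] at ha ht
    obtain ⟨s, rfl⟩ := Nat.exists_eq_add_of_le (show t ≤ n by omega)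
    rw [show p * (t + s) + d - 1 - (p * t + a) = p * s + (d - 1 - a) by rw [mul_add]; omega,
      factorialExponent_noCarry hp rfl hd (by omega) (by omega), Nat.add_sub_cancel_left]
  · rw [Finset.sum_congr rfl (g := fun _ => ∑ t ∈ Finset.range n,
      X ^ (factorialExponent p n t (n - 1 - t) + 1)), Finset.sum_const, Nat.card_Ico,
      nsmul_eq_mul]
    · simp only [pow_succ, ← Finset.sum_mul]
      rw [Nat.cast_sub (by omega)]
      ring
    · intro a ha
      refine Finset.sum_congr rfl fun t ht => ?_
      rw [Finset.mem_Ico] at ha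
      rw [Finset.mem_range] at ht
      obtain ⟨s, rfl⟩ := Nat.exists_eq_add_of_le (show t + 1 ≤ n by omega)
      rw [show p * (t + 1 + s) + d - 1 - (p * t + a) = p * s + (p + d - 1 - a) by
          rw [mul_add, mul_add]; omega,
        factorialExponent_carry hp (by omega) hd (by omega) (by omega)]
      congr 3; omega

@[simp] theorem carryPoly_zero (p : ℕ) : carryPoly p 0 = 1 := by
  simp [carryPoly, factorialExponent]

@[simp] theorem carryPolyIn_zero (p : ℕ) : carryPolyIn p 0 = 0 := by
  simp [carryPolyIn]

theorem carryPoly_digit {p : ℕ} (hp : p.Prime) {d : ℕ} (hd : d < p) :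
    carryPoly p d = (d : ℚ[X]) + 1 := by
  simpa using carryPoly_step hp 0 hd

theorem carryPolyIn_digit {p : ℕ} (hp : p.Prime) {d : ℕ} (hd : d < p) :
    carryPolyIn p d = (d : ℚ[X]) := by
  simpa using carryPolyIn_step hp 0 hd

/-- The digit matrix has determinant `(d+1) X (p-d) - d X (p-1-d) = p X`. Each of the `k` shared low
digits contributes this factor, starting from `T_0 U_a - T_a U_0 = a`. -/
theorem carry_det {p : ℕ} (hp : p.Prime) {a : ℕ} (ha : a < p) (k : ℕ) :
    ∀ m < p ^ k, carryPoly p m * carryPolyIn p (m + a * p ^ k) -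
      carryPoly p (m + a * p ^ k) * carryPolyIn p m = (a : ℚ[X]) * ((p : ℚ[X]) * X) ^ k := by
  induction k with
  | zero =>
    intro m hm
    obtain rfl : m = 0 := by simpa using hm
    simp [carryPolyIn_digit hp ha]
  | succ k ih =>
    intro m hm
    have hlt : m / p < p ^ k := Nat.div_lt_of_lt_mul (by rwa [pow_succ'] at hm)
    have hmod := Nat.mod_lt m hp.pos
    have h1 : m = p * (m / p) + m % p := (Nat.div_add_mod m p).symm
    have h2 : m + a * p ^ (k + 1) = p * (m / p + a * p ^ k) + m % p := by
      rw [mul_add, pow_succ]; nth_rw 1 [h1]; ring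
    rw [h2]
    generalize m % p = d at *
    generalize m / p = m' at *
    subst h1
    rw [carryPoly_step hp _ hmod, carryPoly_step hp _ hmod, carryPolyIn_step hp _ hmod,
      carryPolyIn_step hp _ hmod]
    have := ih m' hlt
    rw [pow_succ, ← mul_assoc, ← this]
    ring

theorem carryPoly_cross {p : ℕ} (hp : p.Prime) {a b k m : ℕ} (ha : a < p) (hb : b < p)
    (hm : m < p ^ k) :
    carryPoly p (p * (m + a * p ^ k) + b) * carryPoly p m -
      carryPoly p (m + a * p ^ k) * carryPoly p (p * m + b) =
      C ((((p : ℚ) - 1 - b) * a) * (p : ℚ) ^ k) * X ^ (k + 1) := by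
  rw [carryPoly_step hp _ hb, carryPoly_step hp _ hb]
  have := carry_det hp ha k m hm
  simp only [map_mul, map_sub, map_pow, map_natCast, map_one]
  linear_combination (X * ((p : ℚ[X]) - 1 - (b : ℚ[X]))) * this

end CarryPolynomials

/-! ### Occurrences of admissible words, read as residues -/

theorem forall_digit_eq_iff {p : ℕ} (hp : p.Prime) {w : List ℕ} (hw : ∀ d ∈ w, d < p) (x : ℕ) :
    (∀ k < w.length, x / p ^ k % p = w.getD k 0) ↔ x % p ^ w.length = Nat.ofDigits p w := by
  induction w generalizing x with
  | nil => simp [Nat.mod_one]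
  | cons d w ih =>
    have hd : d < p := hw d (by simp)
    have ih := ih (fun e he => hw e (by simp [he])) (x / p)
    rw [List.length_cons, pow_succ', Nat.mod_mul, Nat.ofDigits_cons]
    constructor
    · intro h
      rw [ih.1 fun k hk => ?_, show x % p = d by simpa using h 0 (by simp)]
      have := h (k + 1) (by simpa using hk)
      rwa [pow_succ', ← Nat.div_div_eq_div_mul, List.getD_cons_succ] at this
    · intro h
      have h0 : x % p = d := by
        have := congrArg (· % p) h
        simpa [Nat.mod_eq_of_lt hd] using this
      have h1 : x / p % p ^ w.length = Nat.ofDigits p w := by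
        rw [h0] at h
        exact Nat.eq_of_mul_eq_mul_left hp.pos (Nat.add_left_cancel h)
      intro k hk
      cases k with
      | zero => simpa using h0
      | succ k =>
        rw [pow_succ', ← Nat.div_div_eq_div_mul, List.getD_cons_succ]
        exact ih.2 h1 k (by simpa using hk)

namespace IsAdmissible

variable {p : ℕ} {w : List ℕ}

theorem mem_factorPositions_iff (hp : p.Prime) (hw : IsAdmissible p w) (n i : ℕ) :
    i ∈ factorPositions p n w ↔ n / p ^ i % p ^ w.length = Nat.ofDigits p w := by
  rw [← forall_digit_eq_iff hp hw.2.1]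
  simp only [factorPositions, Set.mem_ofPred_eq, Nat.div_div_eq_div_mul, ← pow_add]

theorem digits_ofDigits (hp : p.Prime) (hw : IsAdmissible p w) :
    Nat.digits p (Nat.ofDigits p w) = w := by
  refine Nat.digits_ofDigits p hp.one_lt w hw.2.1 fun h => ?_
  have := hw.2.2.1
  rwa [List.getLast_eq_getElem, ← List.getD_eq_getElem _ 0]

theorem ofDigits_lt (hp : p.Prime) (hw : IsAdmissible p w) :
    Nat.ofDigits p w < p ^ w.length :=
  Nat.ofDigits_lt_base_pow_length hp.one_lt hw.2.1

theorem pow_le_ofDigits (hp : p.Prime) (hw : IsAdmissible p w) :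
    p ^ (w.length - 1) ≤ Nat.ofDigits p w := by
  by_contra! h
  have := (Nat.digits_length_le_iff hp.one_lt _).2 h
  rw [hw.digits_ofDigits hp] at this
  have := hw.1
  omega

theorem le_ofDigits (hp : p.Prime) (hw : IsAdmissible p w) : p ≤ Nat.ofDigits p w :=
  (Nat.le_self_pow (by have := hw.1; omega) p).trans (hw.pow_le_ofDigits hp)

theorem ofDigits_mod_ne (hp : p.Prime) (hw : IsAdmissible p w) :
    Nat.ofDigits p w % p ≠ p - 1 := by
  have := Nat.getD_digits (Nat.ofDigits p w) 0 hp.two_le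
  rw [hw.digits_ofDigits hp] at this
  rw [pow_zero, Nat.div_one] at this
  exact this ▸ hw.2.2.2

theorem factorCount_step (hp : p.Prime) (hw : IsAdmissible p w) (n : ℕ) :
    factorCount p n w =
      factorCount p (n / p) w + if n % p ^ w.length = Nat.ofDigits p w then 1 else 0 := by
  have h0 : (Nat.succ '' factorPositions p (n / p) w).ncard = factorCount p (n / p) w :=
    Set.ncard_image_of_injective _ Nat.succ_injective
  have hsucc : ∀ i, i + 1 ∈ factorPositions p n w ↔ i ∈ factorPositions p (n / p) w := by
    intro i
    rw [hw.mem_factorPositions_iff hp, hw.mem_factorPositions_iff hp, pow_succ',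
      Nat.div_div_eq_div_mul]
  have hzero : 0 ∈ factorPositions p n w ↔ n % p ^ w.length = Nat.ofDigits p w := by
    rw [hw.mem_factorPositions_iff hp, pow_zero, Nat.div_one]
  rw [← h0]
  split_ifs with h
  · rw [← Set.ncard_insert_of_notMem (a := 0) (by simp)
      ((factorPositions_finite hp _ hw).image _)]
    unfold factorCount
    congr 1
    ext i
    cases i with
    | zero => simpa [hzero] using h
    | succ i => simp [hsucc]
  · unfold factorCount
    rw [add_zero]
    congr 1
    ext i
    cases i with
    | zero => simpa [hzero] using h
    | succ i => simp [hsucc]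

theorem factorCount_zero (hp : p.Prime) (hw : IsAdmissible p w) : factorCount p 0 w = 0 := by
  have : factorPositions p 0 w = ∅ := by
    ext i
    have := hw.le_ofDigits hp
    have := hp.pos
    rw [hw.mem_factorPositions_iff hp]
    simp
    omega
  rw [factorCount, this, Set.ncard_empty]

theorem factorCount_of_lt (hp : p.Prime) (hw : IsAdmissible p w) {n : ℕ} (hn : n < p) :
    factorCount p n w = 0 := by
  rw [hw.factorCount_step hp, Nat.div_eq_of_lt hn, hw.factorCount_zero hp, if_neg, zero_add]
  have := hw.le_ofDigits hp
  have := Nat.mod_le n (p ^ w.length)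
  omega

end IsAdmissible

theorem isAdmissible_digits {p n : ℕ} (hp : p.Prime) (hn : p ≤ n) (h : n % p ≠ p - 1) :
    IsAdmissible p (Nat.digits p n) := by
  have hn0 : n ≠ 0 := (hp.pos.trans_le hn).ne'
  have hlen := Nat.length_digits p n hp.one_lt hn0
  have hlog : 1 ≤ Nat.log p n := Nat.log_pos hp.one_lt hn
  refine ⟨by omega, fun d hd => Nat.digits_lt_base hp.one_lt hd, ?_, ?_⟩
  · have := Nat.getLast_digit_ne_zero p hn0
    rwa [List.getLast_eq_getElem, ← List.getD_eq_getElem _ 0] at this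
  · rw [Nat.getD_digits n 0 hp.two_le, pow_zero, Nat.div_one]
    exact h

/-! ### Second differences in the top and last digit -/

/-- The mixed second difference of `f` at `n`, with respect to removing the lowest and the highest
base-`p` digit of `n`. -/
def digitDiff {G : Type*} [AddCommGroup G] (p : ℕ) (f : ℕ → G) (n : ℕ) : G :=
  f n - f (n / p) - f (n % p ^ Nat.log p n) + f (n % p ^ Nat.log p n / p)

section digitDiff

variable {G : Type*} [AddCommGroup G] {p : ℕ}

theorem digitDiff_sub (f g : ℕ → G) (n : ℕ) :
    digitDiff p (fun m => f m - g m) n = digitDiff p f n - digitDiff p g n := by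
  simp only [digitDiff, sub_eq_add_neg, neg_add_rev, neg_neg]; abel

theorem digitDiff_map {H : Type*} [AddCommGroup H] (φ : G →+ H) (f : ℕ → G) (n : ℕ) :
    digitDiff p (fun m => φ (f m)) n = φ (digitDiff p f n) := by
  simp [digitDiff]

theorem digitDiff_sum {ι : Type*} (s : Finset ι) (f : ι → ℕ → G) (n : ℕ) :
    digitDiff p (fun m => ∑ i ∈ s, f i m) n = ∑ i ∈ s, digitDiff p (f i) n := by
  simp [digitDiff, Finset.sum_add_distrib]

theorem digitDiff_const_mul (c : ℚ) (f : ℕ → ℚ) (n : ℕ) :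
    digitDiff p (fun m => c * f m) n = c * digitDiff p f n := by
  unfold digitDiff; ring

theorem mod_pow_log_lt (hp : p.Prime) {n : ℕ} (hn : n ≠ 0) : n % p ^ Nat.log p n < n :=
  (Nat.mod_lt _ (pow_pos hp.pos _)).trans_le (Nat.pow_log_le_self p hn)

/-- A function that vanishes on digits and has vanishing second differences is zero. -/
theorem eq_zero_of_digitDiff_eq_zero (hp : p.Prime) {f : ℕ → G} (h0 : ∀ n < p, f n = 0)
    (h : ∀ n, p ≤ n → digitDiff p f n = 0) (n : ℕ) : f n = 0 := by
  induction n using Nat.strong_induction_on with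
  | _ n ih =>
    by_cases hn : n < p
    · exact h0 n hn
    have hn0 : n ≠ 0 := by have := hp.pos; omega
    have h1 := mod_pow_log_lt hp hn0
    have h2 := Nat.div_lt_self (Nat.pos_of_ne_zero hn0) hp.one_lt
    have := h n (not_lt.1 hn)
    rw [digitDiff, ih _ h1, ih _ h2, ih _ ((Nat.div_le_self _ _).trans_lt h1)] at this
    simpa using this

/-- Removing the last digit loses only a possible occurrence at position `0`. If `n` is longer than
`w`, that occurrence survives removal of the top digit and the terms cancel. Otherwise it can only
be all of `n`, and it disappears with the top digit. -/
theorem digitDiff_factorCount (hp : p.Prime) {w : List ℕ} (hw : IsAdmissible p w) {n : ℕ}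
    (hn : n ≠ 0) :
    digitDiff p (fun m => (factorCount p m w : ℚ)) n = if n = Nat.ofDigits p w then 1 else 0 := by
  have hlow := hw.pow_le_ofDigits hp
  have hup := hw.ofDigits_lt hp
  have hnlow := Nat.pow_log_le_self p hn
  have hnup := Nat.lt_pow_succ_log_self hp.one_lt n
  have hlen := hw.1
  have hlt : n % p ^ Nat.log p n < p ^ Nat.log p n := Nat.mod_lt _ (pow_pos hp.pos _)
  simp only [digitDiff]
  rw [hw.factorCount_step hp n, hw.factorCount_step hp (n % p ^ Nat.log p n)]
  rcases lt_or_ge (Nat.log p n) w.length with hlog | hlog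
  · have h1 : n < p ^ w.length := hnup.trans_le (Nat.pow_le_pow_right hp.pos hlog)
    have h2 : n % p ^ Nat.log p n < p ^ (w.length - 1) :=
      hlt.trans_le (Nat.pow_le_pow_right hp.pos (by omega))
    rw [Nat.mod_eq_of_lt h1, Nat.mod_eq_of_lt (h2.trans (hlow.trans_lt hup)),
      if_neg (h2.trans_le hlow).ne]
    push_cast
    ring
  · have h1 : p ^ w.length ≤ n := (Nat.pow_le_pow_right hp.pos hlog).trans hnlow
    rw [Nat.mod_mod_of_dvd _ (pow_dvd_pow p hlog), if_neg (hup.trans_le h1).ne']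
    push_cast
    ring

end digitDiff

namespace AdmissibleWord

variable {p : ℕ}

/-- The number whose base-`p` expansion is the given word. -/
def val (w : AdmissibleWord p) : ℕ := Nat.ofDigits p w.1

theorem val_injective (hp : p.Prime) : Function.Injective (val (p := p)) := by
  intro w v h
  refine Subtype.ext ?_
  rw [← w.2.digits_ofDigits hp, ← v.2.digits_ofDigits hp]
  exact congrArg _ h

theorem exists_val_eq (hp : p.Prime) {n : ℕ} (hn : p ≤ n) (h : n % p ≠ p - 1) :
    ∃ w : AdmissibleWord p, w.val = n :=
  ⟨⟨_, isAdmissible_digits hp hn h⟩, Nat.ofDigits_digits p n⟩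

theorem finite_val_lt (hp : p.Prime) (M : ℕ) : {w : AdmissibleWord p | w.val < M}.Finite :=
  (Set.finite_Iio M).preimage (val_injective hp).injOn

/-- The number of occurrences of a word, as a rational number. -/
noncomputable def count (n : ℕ) (w : AdmissibleWord p) : ℚ := (factorCount p n w.1 : ℚ)

theorem digitDiff_count (hp : p.Prime) (w : AdmissibleWord p) {n : ℕ} (hn : n ≠ 0) :
    digitDiff p (fun m => count m w) n = if n = w.val then 1 else 0 :=
  digitDiff_factorCount hp w.2 hn

end AdmissibleWord

/-! ### Algebraic independence of the factor counts -/

/-- A polynomial that vanishes on an additive submonoid spanning the whole space is zero. -/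
theorem MvPolynomial.eq_zero_of_eval_addSubmonoid {σ : Type*} (q : MvPolynomial σ ℚ)
    (A : AddSubmonoid (σ → ℚ)) (hA : Submodule.span ℚ (A : Set (σ → ℚ)) = ⊤)
    (h : ∀ a ∈ A, MvPolynomial.eval a q = 0) : q = 0 := by
  -- Along the direction `v` the polynomial vanishes at every natural parameter, since `A` contains
  -- the multiples of `v`; hence at every rational one.
  have line : ∀ v ∈ A, ∀ y : σ → ℚ, (∀ a ∈ A, MvPolynomial.eval (y + a) q = 0) →
      ∀ t : ℚ, ∀ a ∈ A, MvPolynomial.eval (y + t • v + a) q = 0 := by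
    intro v hv y hy t a ha
    let g : Polynomial ℚ := MvPolynomial.eval₂ Polynomial.C
      (fun i => Polynomial.C (y i + a i) + Polynomial.C (v i) * Polynomial.X) q
    have hg : ∀ s : ℚ, g.eval s = MvPolynomial.eval (y + s • v + a) q := by
      intro s
      rw [MvPolynomial.polynomial_eval_eval₂, MvPolynomial.eval, MvPolynomial.coe_eval₂Hom]
      congr 1
      · ext x; simp
      · ext i; simp; ring
    have hg0 : g = 0 := by
      refine Polynomial.eq_zero_of_infinite_isRoot g
        ((Set.infinite_range_of_injective (Nat.cast_injective (R := ℚ))).mono ?_)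
      rintro _ ⟨k, rfl⟩
      change g.eval _ = 0
      rw [hg, add_assoc]
      refine hy _ (A.add_mem ?_ ha)
      rw [Nat.cast_smul_eq_nsmul]
      exact A.nsmul_mem hv k
    rw [← hg, hg0, Polynomial.eval_zero]
  refine MvPolynomial.funext fun x => ?_
  have hx : x ∈ Submodule.span ℚ (A : Set (σ → ℚ)) := hA ▸ Submodule.mem_top
  -- Quantifying over `y` lets translations be composed, so the admissible directions are closed
  -- under addition.
  have key : ∀ t : ℚ, ∀ y : σ → ℚ, (∀ a ∈ A, MvPolynomial.eval (y + a) q = 0) →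
      ∀ a ∈ A, MvPolynomial.eval (y + t • x + a) q = 0 := by
    induction hx using Submodule.span_induction with
    | mem v hv => exact fun t y hy => line v hv y hy t
    | zero => intro t y hy; simpa using hy
    | add v v' _ _ h1 h2 =>
      intro t y hy
      rw [smul_add, ← add_assoc]
      exact h2 t _ (h1 t y hy)
    | smul c v _ h1 =>
      intro t y hy
      rw [smul_smul]
      exact h1 _ y hy
  simpa using key 1 0 (by simpa using h) 0 A.zero_mem

namespace IsAdmissible

variable {p : ℕ} {w : List ℕ}

/-- The `L` zeros separate the blocks: a window of length at most `L` cannot meet both the digits of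
`n` and those of `m`. -/
theorem factorCount_concat (hp : p.Prime) (hw : IsAdmissible p w) {L : ℕ} (hL : w.length ≤ L)
    (n M : ℕ) : ∀ m < p ^ M,
      factorCount p (n * p ^ (M + L) + m) w = factorCount p (n * p ^ L) w + factorCount p m w := by
  induction M with
  | zero =>
    intro m hm
    obtain rfl : m = 0 := by simpa using hm
    simp [hw.factorCount_zero hp]
  | succ M ih =>
    intro m hm
    have hdiv : (n * p ^ (M + 1 + L) + m) / p = n * p ^ (M + L) + m / p := by
      rw [show n * p ^ (M + 1 + L) + m = m + p * (n * p ^ (M + L)) by ring,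
        Nat.add_mul_div_left _ _ hp.pos, add_comm]
    have hmod : (n * p ^ (M + 1 + L) + m) % p ^ w.length = m % p ^ w.length := by
      obtain ⟨c, hc⟩ := pow_dvd_pow p (show w.length ≤ M + 1 + L by omega)
      rw [hc, show n * (p ^ w.length * c) + m = m + p ^ w.length * (n * c) by ring,
        Nat.add_mul_mod_self_left]
    rw [hw.factorCount_step hp, hw.factorCount_step hp m, hdiv, hmod,
      ih _ (Nat.div_lt_of_lt_mul (by rwa [pow_succ'] at hm)), add_assoc]

/-- No admissible word ends in the digit `p - 1`. -/
theorem factorCount_append_top_digits (hp : p.Prime) (hw : IsAdmissible p w) (n j : ℕ) :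
    factorCount p (n * p ^ j + (p ^ j - 1)) w = factorCount p n w := by
  induction j with
  | zero => simp
  | succ j ih =>
    have hpos : 0 < p ^ j := pow_pos hp.pos j
    have hp1 := hp.pos
    have hx : n * p ^ (j + 1) + (p ^ (j + 1) - 1) = (p - 1) + p * (n * p ^ j + (p ^ j - 1)) := by
      obtain ⟨c, hc⟩ : ∃ c, p ^ j = c + 1 := ⟨p ^ j - 1, by omega⟩
      obtain ⟨e, rfl⟩ : ∃ e, p = e + 1 := ⟨p - 1, by omega⟩
      rw [pow_succ, hc, show (c + 1) * (e + 1) = c * (e + 1) + e + 1 by ring]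
      simp only [Nat.add_sub_cancel]
      ring
    rw [hx, hw.factorCount_step hp, Nat.add_mul_div_left _ _ hp.pos,
      Nat.div_eq_of_lt (by omega), zero_add, ih, if_neg, add_zero]
    intro h
    apply hw.ofDigits_mod_ne hp
    rw [← h, Nat.mod_mod_of_dvd _ (dvd_pow_self p (by have := hw.1; omega)),
      Nat.add_mul_mod_self_left, Nat.mod_eq_of_lt (by omega)]

/-- The occurrences created by appending zeros depend only on the last `w.length` digits. -/
theorem factorCount_mul_pow_congr (hp : p.Prime) (hw : IsAdmissible p w) {y z : ℕ}
    (h : y ≡ z [MOD p ^ w.length]) (i : ℕ) :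
    factorCount p (y * p ^ i) w + factorCount p z w =
      factorCount p (z * p ^ i) w + factorCount p y w := by
  induction i with
  | zero => simp [add_comm]
  | succ i ih =>
    have hdiv : ∀ x, x * p ^ (i + 1) / p = x * p ^ i := fun x => by
      rw [pow_succ, ← mul_assoc, Nat.mul_div_cancel _ hp.pos]
    have hmod : y * p ^ (i + 1) % p ^ w.length = z * p ^ (i + 1) % p ^ w.length :=
      h.mul_right _
    rw [hw.factorCount_step hp, hw.factorCount_step hp (z * p ^ (i + 1)), hdiv, hdiv, hmod]
    omega

end IsAdmissible

namespace AdmissibleWord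

variable {p : ℕ}

/-- The vectors of factor counts of `n`, followed by `L` zeros. -/
noncomputable def paddedCounts (hp : p.Prime) (S : Finset (AdmissibleWord p)) (L : ℕ)
    (hL : ∀ w ∈ S, w.1.length ≤ L) : AddSubmonoid (S → ℚ) where
  carrier := Set.range fun (n : ℕ) (w : S) => count (n * p ^ L) w.1
  zero_mem' := ⟨0, by ext w; simp [count, w.1.2.factorCount_zero hp]⟩
  add_mem' := by
    rintro _ _ ⟨n, rfl⟩ ⟨m, rfl⟩
    -- After multiplication by `p ^ L` the lower block is `m * p ^ L`, which is less than `p ^ (m *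
    -- p ^ L)`.
    refine ⟨n * p ^ (m * p ^ L) + m, ?_⟩
    ext w
    simp only [count, Pi.add_apply, ← Nat.cast_add]
    rw [← w.1.2.factorCount_concat hp (hL _ w.2) n _ _ (Nat.lt_pow_self hp.one_lt)]
    congr 2
    ring

/-- A functional killing all padded counts kills all counts: append `L` digits `p - 1` and then `L`
zeros to `n`, and subtract the case `n = 0`. The second difference at `v` then isolates the
coefficient of `v`. -/
theorem span_paddedCounts (hp : p.Prime) (S : Finset (AdmissibleWord p)) (L : ℕ)
    (hL : ∀ w ∈ S, w.1.length ≤ L) :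
    Submodule.span ℚ (paddedCounts hp S L hL : Set (S → ℚ)) = ⊤ := by
  classical
  by_contra hne
  obtain ⟨φ, hφ, hle⟩ := Submodule.exists_le_ker_of_lt_top _ (lt_top_iff_ne_top.2 hne)
  refine hφ ?_
  set lam : S → ℚ := fun w => φ (Pi.single w 1) with hlam
  have hφ_eq : ∀ x : S → ℚ, φ x = ∑ w, x w * lam w := by
    intro x
    conv_lhs => rw [pi_eq_sum_univ' x, map_sum]
    refine Finset.sum_congr rfl fun w _ => ?_
    rw [map_smul, smul_eq_mul, hlam]
  have hpad : ∀ n, ∑ w : S, count (n * p ^ L) w.1 * lam w = 0 := by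
    intro n
    rw [← hφ_eq fun w => count (n * p ^ L) w.1]
    exact hle (Submodule.subset_span ⟨n, rfl⟩)
  have hzero : ∀ n, ∑ w : S, count n w.1 * lam w = 0 := by
    intro n
    have h1 := hpad (n * p ^ L + (p ^ L - 1))
    have h2 := hpad (p ^ L - 1)
    have h3 : ∀ w : S, count ((n * p ^ L + (p ^ L - 1)) * p ^ L) w.1 =
        count ((p ^ L - 1) * p ^ L) w.1 + count n w.1 := by
      intro w
      have hmod : n * p ^ L + (p ^ L - 1) ≡ p ^ L - 1 [MOD p ^ w.1.1.length] := by
        obtain ⟨c, hc⟩ := pow_dvd_pow p (hL _ w.2)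
        have : n * p ^ L = p ^ w.1.1.length * (n * c) := by rw [hc]; ring
        rw [this, add_comm]
        exact Nat.add_mul_mod_self_left _ _ _
      have h4 := w.1.2.factorCount_mul_pow_congr hp hmod L
      have h5 := w.1.2.factorCount_append_top_digits hp 0 L
      rw [zero_mul, zero_add, w.1.2.factorCount_zero hp] at h5
      rw [w.1.2.factorCount_append_top_digits hp, h5, add_zero] at h4
      unfold count
      exact_mod_cast h4
    simp only [h3] at h1
    simp only [add_mul (count ((p ^ L - 1) * p ^ L) _), Finset.sum_add_distrib, h2, zero_add] at h1
    exact h1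
  have hlam0 : ∀ v : S, lam v = 0 := by
    intro v
    have hv : v.1.val ≠ 0 := (hp.pos.trans_le (v.1.2.le_ofDigits hp)).ne'
    have h1 : digitDiff p (fun n => ∑ w : S, lam w * count n w.1) v.1.val = lam v := by
      rw [digitDiff_sum, Finset.sum_eq_single v]
      · rw [digitDiff_const_mul, digitDiff_count hp _ hv]
        simp
      · intro w _ hne
        rw [digitDiff_const_mul, digitDiff_count hp _ hv, if_neg]
        · simp
        · exact fun h => hne (Subtype.ext (val_injective hp h).symm)
      · simp
    rw [← h1]
    simp only [mul_comm (lam _), hzero]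
    simp [digitDiff]
  ext w
  simpa [hlam] using hlam0 w

/-- The factor counts are algebraically independent. -/
theorem eq_zero_of_eval_count_eq_zero (hp : p.Prime) (Q : MvPolynomial (AdmissibleWord p) ℚ)
    (h : ∀ n, MvPolynomial.eval (count n) Q = 0) : Q = 0 := by
  obtain ⟨S, q, rfl⟩ := MvPolynomial.exists_finset_rename Q
  have hL : ∀ w ∈ S, w.1.length ≤ S.sup fun w => w.1.length := fun w hw =>
    Finset.le_sup (f := fun w : AdmissibleWord p => w.1.length) hw
  rw [MvPolynomial.eq_zero_of_eval_addSubmonoid q (paddedCounts hp S _ hL)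
    (span_paddedCounts hp S _ hL), map_zero]
  rintro _ ⟨n, rfl⟩
  have := h (n * p ^ S.sup fun w => w.1.length)
  rwa [MvPolynomial.eval_rename] at this

end AdmissibleWord

/-! ### Formal linear differential equations `E' = G E` -/

section LinearODE

open PowerSeries

variable {A : Type*} [CommRing A]

theorem derivative_map {B : Type*} [CommRing B] (φ : A →+* B) (F : A⟦X⟧) :
    derivative B (PowerSeries.map φ F) = PowerSeries.map φ (derivative A F) := by
  ext n
  simp [coeff_derivative]

variable [Algebra ℚ A]

/-- The coefficients of the solution of `E' = G * E` with constant coefficient `1`. -/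
noncomputable def odeCoeff (G : A⟦X⟧) : ℕ → A
  | 0 => 1
  | n + 1 => ((n : ℚ) + 1)⁻¹ • ∑ i : Fin (n + 1), odeCoeff G i * coeff (n - i) G
  decreasing_by exact i.2

/-- The solution of `E' = G * E` with constant coefficient `1`. -/
noncomputable def odeSolution (G : A⟦X⟧) : A⟦X⟧ := PowerSeries.mk (odeCoeff G)

theorem constantCoeff_odeSolution (G : A⟦X⟧) : constantCoeff (odeSolution G) = 1 := by
  rw [← coeff_zero_eq_constantCoeff_apply, odeSolution, coeff_mk, odeCoeff]

theorem derivative_odeSolution (G : A⟦X⟧) :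
    derivative A (odeSolution G) = G * odeSolution G := by
  ext n
  rw [coeff_derivative, mul_comm G, coeff_mul, Finset.Nat.sum_antidiagonal_eq_sum_range_succ_mk,
    odeSolution]
  simp only [coeff_mk]
  rw [odeCoeff, Finset.sum_range fun i => odeCoeff G i * coeff (n - i) G, smul_mul_assoc,
    show (n : A) + 1 = algebraMap ℚ A ((n : ℚ) + 1) by simp, mul_comm, ← Algebra.smul_def,
    smul_smul, inv_mul_cancel₀ (by positivity), one_smul]

theorem eq_zero_of_derivative_eq_mul {G F : A⟦X⟧} (h : derivative A F = G * F)
    (h0 : constantCoeff F = 0) : F = 0 := by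
  have key : ∀ n, coeff n F = 0 := by
    intro n
    induction n using Nat.strong_induction_on with
    | _ n ih =>
      cases n with
      | zero => rwa [coeff_zero_eq_constantCoeff_apply]
      | succ n =>
        have h1 := congrArg (coeff n) h
        rw [coeff_derivative, coeff_mul, Finset.sum_eq_zero] at h1
        · rw [show (n : A) + 1 = algebraMap ℚ A ((n : ℚ) + 1) by simp, mul_comm,
            ← Algebra.smul_def] at h1
          have h2 := congrArg (((n : ℚ) + 1)⁻¹ • ·) h1
          simpa only [smul_smul, inv_mul_cancel₀ (show (n : ℚ) + 1 ≠ 0 by positivity), one_smul,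
            smul_zero] using h2
        · intro x hx
          rw [ih x.2 (by have := Finset.HasAntidiagonal.mem_antidiagonal.1 hx; omega), mul_zero]
  ext n
  rw [key, map_zero]

theorem eq_of_derivative_eq_mul {G E F : A⟦X⟧} (hE : derivative A E = G * E)
    (hF : derivative A F = G * F) (h0 : constantCoeff E = constantCoeff F) : E = F := by
  refine sub_eq_zero.1 (eq_zero_of_derivative_eq_mul (G := G) ?_ ?_)
  · rw [map_sub, hE, hF, mul_sub]
  · rw [map_sub, h0, sub_self]

/-- A derivation of the coefficient ring, applied to each coefficient of a power series. -/
noncomputable def coeffwise (D : Derivation ℚ A A) (F : A⟦X⟧) : A⟦X⟧ :=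
  PowerSeries.mk fun n => D (coeff n F)

theorem coeffwise_mul (D : Derivation ℚ A A) (F G : A⟦X⟧) :
    coeffwise D (F * G) = coeffwise D F * G + F * coeffwise D G := by
  ext n
  simp only [coeffwise, coeff_mk, map_add, coeff_mul, map_sum, Derivation.leibniz, smul_eq_mul,
    ← Finset.sum_add_distrib]
  exact Finset.sum_congr rfl fun x _ => by ring

theorem derivative_coeffwise (D : Derivation ℚ A A) (F : A⟦X⟧) :
    derivative A (coeffwise D F) = coeffwise D (derivative A F) := by
  ext n
  simp only [coeffwise, coeff_mk, coeff_derivative, Derivation.leibniz, smul_eq_mul, map_add,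
    Derivation.map_natCast, Derivation.map_one_eq_zero]
  ring

/-- If `D G = c'`, then the solution `E` of `E' = G * E` satisfies `D E = c * E`. -/
theorem coeffwise_odeSolution (D : Derivation ℚ A A) {G c : A⟦X⟧}
    (hc : coeffwise D G = derivative A c) (hc0 : constantCoeff c = 0) :
    coeffwise D (odeSolution G) = c * odeSolution G := by
  -- `D E - c E` solves the same equation with initial value `0`.
  refine sub_eq_zero.1 (eq_zero_of_derivative_eq_mul (G := G) ?_ ?_)
  · rw [map_sub, derivative_coeffwise, Derivation.leibniz, derivative_odeSolution, coeffwise_mul,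
      hc, smul_eq_mul, smul_eq_mul]
    ring
  · rw [map_sub, map_mul, hc0, zero_mul, sub_zero, ← coeff_zero_eq_constantCoeff_apply, coeffwise,
      coeff_mk, coeff_zero_eq_constantCoeff_apply, constantCoeff_odeSolution,
      Derivation.map_one_eq_zero]

/-- The antiderivative with constant coefficient `0`. -/
noncomputable def antiderivative (F : ℚ⟦X⟧) : ℚ⟦X⟧ :=
  PowerSeries.mk fun n => coeff (n - 1) F * if n = 0 then 0 else (n : ℚ)⁻¹

theorem constantCoeff_antiderivative (F : ℚ⟦X⟧) : constantCoeff (antiderivative F) = 0 := by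
  rw [← coeff_zero_eq_constantCoeff_apply, antiderivative, coeff_mk, if_pos rfl, mul_zero]

theorem derivative_antiderivative (F : ℚ⟦X⟧) : derivative ℚ (antiderivative F) = F := by
  ext n
  have : (n : ℚ) + 1 ≠ 0 := by positivity
  simp [coeff_derivative, antiderivative, this]

/-- The power series of the coefficients of the monomial `m`. -/
noncomputable def coeffSeries {σ : Type*} (m : σ →₀ ℕ) (E : (MvPolynomial σ ℚ)⟦X⟧) : ℚ⟦X⟧ :=
  PowerSeries.mk fun n => MvPolynomial.coeff m (coeff n E)

theorem coeffSeries_map_C_mul {σ : Type*} (m : σ →₀ ℕ) (c : ℚ⟦X⟧) (E : (MvPolynomial σ ℚ)⟦X⟧) :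
    coeffSeries m (PowerSeries.map MvPolynomial.C c * E) = c * coeffSeries m E := by
  ext n
  simp [coeffSeries, coeff_mul, MvPolynomial.coeff_sum, MvPolynomial.coeff_C_mul]

theorem coeffSeries_add_single {σ : Type*} {E : (MvPolynomial σ ℚ)⟦X⟧} {c : σ → ℚ⟦X⟧}
    (h : ∀ w, coeffwise (MvPolynomial.pderiv w) E =
      PowerSeries.map MvPolynomial.C (c w) * E) (w : σ) (m : σ →₀ ℕ) :
    coeffSeries (m + Finsupp.single w 1) E =
      PowerSeries.C (((m w : ℚ) + 1)⁻¹) * c w * coeffSeries m E := by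
  have h1 := congrArg (coeffSeries m) (h w)
  rw [coeffSeries_map_C_mul] at h1
  rw [mul_assoc, ← h1]
  ext n
  have : (m w : ℚ) + 1 ≠ 0 := by positivity
  simp only [coeffSeries, coeffwise, coeff_mk, coeff_C_mul, MvPolynomial.coeff_pderiv]
  field_simp

/-- The hypothesis says that `E` behaves like `exp(Σ c_w X_w)`, so `r` is a product of inverse
factorials; only `r ≠ 0` is needed. -/
theorem exists_coeffSeries_eq {σ : Type*} {E : (MvPolynomial σ ℚ)⟦X⟧} {c : σ → ℚ⟦X⟧}
    (h : ∀ w, coeffwise (MvPolynomial.pderiv w) E =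
      PowerSeries.map MvPolynomial.C (c w) * E) (m : σ →₀ ℕ) :
    ∃ r : ℚ, r ≠ 0 ∧
      coeffSeries m E = PowerSeries.C r * m.prod (fun w k => c w ^ k) * coeffSeries 0 E := by
  classical
  suffices H : ∀ m₀, ∃ r : ℚ, r ≠ 0 ∧ coeffSeries (m₀ + m) E =
      PowerSeries.C r * m.prod (fun w k => c w ^ k) * coeffSeries m₀ E by
    simpa using H 0
  induction m using Finsupp.induction_linear with
  | zero => exact fun m₀ => ⟨1, one_ne_zero, by simp⟩
  | add f g hf hg =>
    intro m₀
    obtain ⟨r, hr, h1⟩ := hf m₀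
    obtain ⟨s, hs, h2⟩ := hg (m₀ + f)
    refine ⟨s * r, mul_ne_zero hs hr, ?_⟩
    rw [← add_assoc, h2, h1, Finsupp.prod_add_index' (by simp) (by simp [pow_add]), map_mul]
    ring
  | single w k =>
    intro m₀
    induction k with
    | zero => exact ⟨1, one_ne_zero, by simp⟩
    | succ k ih =>
      obtain ⟨r, hr, h1⟩ := ih
      rw [Finsupp.prod_single_index (h := fun w k => c w ^ k) (pow_zero _)] at h1
      refine ⟨(((m₀ + Finsupp.single w k) w : ℚ) + 1)⁻¹ * r,
        mul_ne_zero (by positivity) hr, ?_⟩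
      rw [Finsupp.single_add, ← add_assoc, coeffSeries_add_single h, h1, ← Finsupp.single_add,
        Finsupp.prod_single_index (h := fun w k => c w ^ k) (pow_zero _), pow_succ, map_mul]
      ring

end LinearODE

/-! ### The logarithmic second difference of the carry polynomials -/

section LogDeriv

open PowerSeries

/-- The logarithmic derivative of a power series. -/
noncomputable def seriesLogDeriv (F : ℚ⟦X⟧) : ℚ⟦X⟧ := derivative ℚ F * F⁻¹

theorem seriesLogDeriv_mul_self {F : ℚ⟦X⟧} (hF : constantCoeff F ≠ 0) :
    seriesLogDeriv F * F = derivative ℚ F := by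
  rw [seriesLogDeriv, mul_assoc, PowerSeries.inv_mul_cancel _ hF, mul_one]

/-- The polynomial `carryPoly p n` as a power series. -/
noncomputable def carrySeries (p n : ℕ) : ℚ⟦X⟧ := (carryPoly p n : ℚ⟦X⟧)

variable {p : ℕ}

theorem coeff_carrySeries (hp : p.Prime) (n j : ℕ) :
    coeff j (carrySeries p n) = vartheta p j n := by
  rw [carrySeries, Polynomial.coeff_coe, coeff_carryPoly hp]

theorem constantCoeff_carrySeries_ne_zero (hp : p.Prime) (n : ℕ) :
    constantCoeff (carrySeries p n) ≠ 0 := by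
  rw [← coeff_zero_eq_constantCoeff_apply, coeff_carrySeries hp]
  exact_mod_cast (vartheta_zero_pos p n).ne'

/-- The numerator in the second difference of `n ↦ log (carryPoly p n)`. -/
noncomputable def crossNum (p n : ℕ) : Polynomial ℚ :=
  carryPoly p n * carryPoly p (n % p ^ Nat.log p n / p)

/-- The denominator in the second difference of `n ↦ log (carryPoly p n)`. -/
noncomputable def crossDen (p n : ℕ) : Polynomial ℚ :=
  carryPoly p (n / p) * carryPoly p (n % p ^ Nat.log p n)

/-- Split `n` into top digit, middle block and last digit `b`. In `δ = (p-1-b) a p^k` only the first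
factor can vanish, as the top digit `a` is nonzero. -/
theorem exists_crossNum_sub_crossDen (hp : p.Prime) {n : ℕ} (hn : p ≤ n) :
    ∃ δ : ℚ, (δ = 0 ↔ n % p = p - 1) ∧
      crossNum p n - crossDen p n = Polynomial.C δ * Polynomial.X ^ (Nat.log p n - 1 + 1) := by
  have hlog : 1 ≤ Nat.log p n := Nat.log_pos hp.one_lt hn
  have hn0 : n ≠ 0 := (hp.pos.trans_le hn).ne'
  have hnlow := Nat.pow_log_le_self p hn0
  have hnup := Nat.lt_pow_succ_log_self hp.one_lt n
  unfold crossNum crossDen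
  obtain ⟨k, hk⟩ : ∃ k, Nat.log p n = k + 1 := ⟨_, (Nat.sub_add_cancel hlog).symm⟩
  rw [hk] at hnlow hnup ⊢
  have hpk : 0 < p ^ (k + 1) := pow_pos hp.pos _
  have hlt : n % p ^ (k + 1) < p ^ (k + 1) := Nat.mod_lt _ hpk
  have ha : n / p ^ (k + 1) < p := Nat.div_lt_of_lt_mul (by rwa [pow_succ] at hnup)
  have ha0 : 0 < n / p ^ (k + 1) := Nat.div_pos hnlow hpk
  have hb : n % p < p := Nat.mod_lt _ hp.pos
  have hn' : n % p ^ (k + 1) = p * (n % p ^ (k + 1) / p) + n % p := by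
    conv_lhs => rw [← Nat.div_add_mod (n % p ^ (k + 1)) p]
    rw [Nat.mod_mod_of_dvd _ (dvd_pow_self p k.succ_ne_zero)]
  have hm : n % p ^ (k + 1) / p < p ^ k := Nat.div_lt_of_lt_mul (hlt.trans_eq (pow_succ' p k))
  have hn1 : n = p * (n % p ^ (k + 1) / p + n / p ^ (k + 1) * p ^ k) + n % p := by
    conv_lhs => rw [← Nat.mod_add_div n (p ^ (k + 1)), hn']
    ring
  have hn2 : n / p = n % p ^ (k + 1) / p + n / p ^ (k + 1) * p ^ k := by
    conv_lhs => rw [hn1]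
    rw [Nat.mul_add_div hp.pos, Nat.div_eq_of_lt hb, add_zero]
  have key := carryPoly_cross hp ha hb hm
  rw [← hn1, ← hn2, ← hn'] at key
  refine ⟨_, ?_, key⟩
  have h1 : ((n / p ^ (k + 1) : ℕ) : ℚ) ≠ 0 := by exact_mod_cast ha0.ne'
  have h2 : (p : ℚ) ^ k ≠ 0 := by exact_mod_cast (pow_pos hp.pos k).ne'
  simp only [mul_eq_zero, h1, h2, or_false]
  rw [sub_sub, sub_eq_zero]
  have := hp.pos
  constructor
  · intro h
    have h' : p = 1 + n % p := by exact_mod_cast h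
    omega
  · intro h
    rw [h]
    push_cast [Nat.cast_sub hp.one_lt.le]
    ring

/-- The second difference of `n ↦ (log T_n)'`, where `T_n` is the polynomial `carryPoly p n`. -/
noncomputable def crossLogDeriv (p n : ℕ) : ℚ⟦X⟧ :=
  digitDiff p (fun m => seriesLogDeriv (carrySeries p m)) n

theorem constantCoeff_crossNum_ne_zero (hp : p.Prime) (n : ℕ) :
    constantCoeff (crossNum p n : ℚ⟦X⟧) ≠ 0 := by
  rw [crossNum, Polynomial.coe_mul, map_mul]
  exact mul_ne_zero (constantCoeff_carrySeries_ne_zero hp _)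
    (constantCoeff_carrySeries_ne_zero hp _)

theorem constantCoeff_crossDen_ne_zero (hp : p.Prime) (n : ℕ) :
    constantCoeff (crossDen p n : ℚ⟦X⟧) ≠ 0 := by
  rw [crossDen, Polynomial.coe_mul, map_mul]
  exact mul_ne_zero (constantCoeff_carrySeries_ne_zero hp _)
    (constantCoeff_carrySeries_ne_zero hp _)

theorem crossLogDeriv_mul (hp : p.Prime) (n : ℕ) :
    crossLogDeriv p n * (crossNum p n * crossDen p n) =
      derivative ℚ (crossNum p n : ℚ⟦X⟧) * crossDen p n -
        crossNum p n * derivative ℚ (crossDen p n : ℚ⟦X⟧) := by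
  have h : ∀ m, seriesLogDeriv (carrySeries p m) * carrySeries p m =
    derivative ℚ (carrySeries p m) := fun m =>
      seriesLogDeriv_mul_self (constantCoeff_carrySeries_ne_zero hp m)
  have hN : (crossNum p n : ℚ⟦X⟧) =
    carrySeries p n * carrySeries p (n % p ^ Nat.log p n / p) := Polynomial.coe_mul ..
  have hD : (crossDen p n : ℚ⟦X⟧) =
    carrySeries p (n / p) * carrySeries p (n % p ^ Nat.log p n) := Polynomial.coe_mul ..
  rw [hN, hD]
  simp only [crossLogDeriv, digitDiff, Derivation.leibniz, smul_eq_mul, ← h]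
  ring

/-- From `A = B + δ X^(k+1)` one gets `A' B - A B' = δ X^k ((k+1) B - X B')`; the unit `u` is the
bracket divided by `A B`. -/
theorem exists_crossLogDeriv_eq (hp : p.Prime) {n : ℕ} (hn : p ≤ n) :
    ∃ (δ : ℚ) (u : ℚ⟦X⟧), (δ = 0 ↔ n % p = p - 1) ∧ constantCoeff u ≠ 0 ∧
      crossLogDeriv p n = C δ * X ^ (Nat.log p n - 1) * u := by
  obtain ⟨δ, hδ, h⟩ := exists_crossNum_sub_crossDen hp hn
  have hA := constantCoeff_crossNum_ne_zero hp n
  have hB := constantCoeff_crossDen_ne_zero hp n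
  have hmul := crossLogDeriv_mul hp n
  have h' : (crossNum p n : ℚ⟦X⟧) = (crossDen p n : ℚ⟦X⟧) + C δ * X ^ (Nat.log p n - 1 + 1) := by
    rw [← sub_eq_iff_eq_add', ← Polynomial.coe_sub, h]
    simp
  generalize Nat.log p n - 1 = k at *
  generalize (crossNum p n : ℚ⟦X⟧) = A at *
  generalize (crossDen p n : ℚ⟦X⟧) = B at *
  refine ⟨δ, (((k : ℚ⟦X⟧) + 1) * B - X * derivative ℚ B) * A⁻¹ * B⁻¹, hδ, ?_, ?_⟩
  · simp only [map_mul, map_sub, map_add, map_natCast, map_one, constantCoeff_X, zero_mul,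
      sub_zero, constantCoeff_inv]
    have : (k : ℚ) + 1 ≠ 0 := by positivity
    positivity
  · have hAA := PowerSeries.mul_inv_cancel A hA
    have hBB := PowerSeries.mul_inv_cancel B hB
    have h1 : derivative ℚ A * B - A * derivative ℚ B =
        C δ * X ^ k * (((k : ℚ⟦X⟧) + 1) * B - X * derivative ℚ B) := by
      rw [h']
      simp only [map_add, Derivation.leibniz, derivative_C, Derivation.leibniz_pow, derivative_X,
        smul_eq_mul, nsmul_eq_mul]
      push_cast
      ring
    calc crossLogDeriv p n = crossLogDeriv p n * (A * B) * (A⁻¹ * B⁻¹) := by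
          linear_combination (-crossLogDeriv p n) * (B * B⁻¹) * hAA - crossLogDeriv p n * hBB
      _ = _ := by rw [hmul, h1]; ring

theorem seriesLogDeriv_carrySeries_digit (hp : p.Prime) {n : ℕ} (hn : n < p) :
    seriesLogDeriv (carrySeries p n) = 0 := by
  have : carrySeries p n = C ((n : ℚ) + 1) := by
    rw [carrySeries, carryPoly_digit hp hn,
      show (n : Polynomial ℚ) + 1 = Polynomial.C ((n : ℚ) + 1) by simp, Polynomial.coe_C]
  rw [seriesLogDeriv, this, derivative_C, zero_mul]

theorem coeff_crossLogDeriv_eq_zero (hp : p.Prime) {n j : ℕ} (hn : p ^ (j + 2) ≤ n) :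
    coeff j (crossLogDeriv p n) = 0 := by
  obtain ⟨δ, u, -, -, h⟩ := exists_crossLogDeriv_eq hp
    ((Nat.le_self_pow (by omega) p).trans hn)
  have hlog : j + 2 ≤ Nat.log p n := Nat.le_log_of_pow_le hp.one_lt hn
  rw [h, mul_assoc, coeff_C_mul, coeff_X_pow_mul', if_neg (by omega), mul_zero]

end LogDeriv

/-! ### The generating series of the representing polynomials -/

namespace AdmissibleWord

open PowerSeries

variable {p : ℕ}

/-- The words that contribute to the coefficient of degree `j`. -/
noncomputable def shortWords (hp : p.Prime) (j : ℕ) : Finset (AdmissibleWord p) :=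
  (finite_val_lt hp (p ^ (j + 2))).toFinset

theorem mem_shortWords (hp : p.Prime) {j : ℕ} {w : AdmissibleWord p} :
    w ∈ shortWords hp j ↔ w.val < p ^ (j + 2) := by
  simp [shortWords]

/-- The logarithmic derivative of `carryPoly p n` is a combination of factor counts. -/
theorem sum_count_mul_coeff (hp : p.Prime) (j n : ℕ) :
    ∑ w ∈ shortWords hp j, coeff j (crossLogDeriv p w.val) * count n w =
      coeff j (seriesLogDeriv (carrySeries p n)) := by
  refine sub_eq_zero.1 (eq_zero_of_digitDiff_eq_zero hp (f := fun n =>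
    ∑ w ∈ shortWords hp j, coeff j (crossLogDeriv p w.val) * count n w -
      coeff j (seriesLogDeriv (carrySeries p n))) ?_ ?_ n)
  · intro n hn
    rw [seriesLogDeriv_carrySeries_digit hp hn, map_zero, sub_zero]
    refine Finset.sum_eq_zero fun w _ => ?_
    rw [count, w.2.factorCount_of_lt hp hn, Nat.cast_zero, mul_zero]
  · intro n hn
    have hn0 : n ≠ 0 := (hp.pos.trans_le hn).ne'
    have hmap : digitDiff p (fun n => coeff j (seriesLogDeriv (carrySeries p n))) n =
        coeff j (crossLogDeriv p n) :=
      digitDiff_map (coeff (R := ℚ) j).toAddMonoidHom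
        (fun n => seriesLogDeriv (carrySeries p n)) n
    rw [digitDiff_sub, digitDiff_sum, hmap, sub_eq_zero]
    simp only [digitDiff_const_mul, digitDiff_count hp _ hn0]
    -- With last digit `p - 1`, `n` spells no admissible word and `δ = 0`, so both sides vanish.
    by_cases hlast : n % p = p - 1
    · obtain ⟨δ, u, hδ, -, h⟩ := exists_crossLogDeriv_eq hp hn
      rw [h, hδ.2 hlast]
      simp only [map_zero, zero_mul]
      refine Finset.sum_eq_zero fun w _ => ?_
      rw [if_neg, mul_zero]
      rintro rfl
      exact w.2.ofDigits_mod_ne hp hlast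
    obtain ⟨v, rfl⟩ := exists_val_eq hp hn hlast
    by_cases hv : v.val < p ^ (j + 2)
    · rw [Finset.sum_eq_single_of_mem v ((mem_shortWords hp).2 hv), if_pos rfl, mul_one]
      intro w _ hw
      rw [if_neg, mul_zero]
      exact fun h => hw (val_injective hp h.symm)
    · rw [coeff_crossLogDeriv_eq_zero hp (not_lt.1 hv)]
      refine Finset.sum_eq_zero fun w hw => ?_
      rw [if_neg, mul_zero]
      rintro h
      exact hv (h ▸ (mem_shortWords hp).1 hw)

/-- The series `∑ w, X_w * (log r_w)'`, where `log r_w` is the second difference at `w` of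
`n ↦ log (carryPoly p n)`. -/
noncomputable def potential (hp : p.Prime) : (MvPolynomial (AdmissibleWord p) ℚ)⟦X⟧ :=
  PowerSeries.mk fun j => ∑ w ∈ shortWords hp j,
    MvPolynomial.C (coeff j (crossLogDeriv p w.val)) * MvPolynomial.X w

/-- The generating series of the polynomials that represent `vartheta p j n / vartheta p 0 n`. -/
noncomputable def ratioSeries (hp : p.Prime) : (MvPolynomial (AdmissibleWord p) ℚ)⟦X⟧ :=
  odeSolution (potential hp)

/-- Both sides solve `F' = (T_n' / T_n) F` with constant coefficient `1`. -/
theorem map_eval_ratioSeries (hp : p.Prime) (n : ℕ) :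
    PowerSeries.map (MvPolynomial.eval (count n)) (ratioSeries hp) =
      C (constantCoeff (carrySeries p n))⁻¹ * carrySeries p n := by
  have h0 := constantCoeff_carrySeries_ne_zero hp n
  refine eq_of_derivative_eq_mul (G := seriesLogDeriv (carrySeries p n)) ?_ ?_ ?_
  · rw [derivative_map, ratioSeries, derivative_odeSolution, map_mul]
    congr 1
    ext j
    rw [← sum_count_mul_coeff hp]
    simp [potential]
  · rw [Derivation.leibniz, derivative_C, smul_zero, add_zero, smul_eq_mul,
      ← seriesLogDeriv_mul_self h0]
    ring
  · rw [map_mul, constantCoeff_C, inv_mul_cancel₀ h0, ← coeff_zero_eq_constantCoeff_apply,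
      coeff_map, coeff_zero_eq_constantCoeff_apply, ratioSeries, constantCoeff_odeSolution,
      map_one]

theorem representsRatio_coeff_ratioSeries (hp : p.Prime) (j : ℕ) :
    RepresentsRatio p j (coeff j (ratioSeries hp)) := by
  intro n
  have h := congrArg (coeff j) (map_eval_ratioSeries hp n)
  rw [coeff_map, coeff_C_mul, coeff_carrySeries hp, ← coeff_zero_eq_constantCoeff_apply,
    coeff_carrySeries hp] at h
  rw [div_eq_inv_mul, ← h]
  rfl

theorem representsRatio_iff (hp : p.Prime) (j : ℕ) (Q : MvPolynomial (AdmissibleWord p) ℚ) :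
    RepresentsRatio p j Q ↔ Q = coeff j (ratioSeries hp) := by
  refine ⟨fun h => sub_eq_zero.1 (eq_zero_of_eval_count_eq_zero hp _ fun n => ?_), ?_⟩
  · rw [map_sub, sub_eq_zero]
    exact (h n).trans (representsRatio_coeff_ratioSeries hp j n).symm
  · rintro rfl
    exact representsRatio_coeff_ratioSeries hp j

/-- The power series `log r_w`, the second difference at `w` of `n ↦ log (carryPoly p n)`. -/
noncomputable def logSeries (w : AdmissibleWord p) : ℚ⟦X⟧ :=
  antiderivative (crossLogDeriv p w.val)

theorem logSeries_ne_zero (hp : p.Prime) (w : AdmissibleWord p) : w.logSeries ≠ 0 := by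
  intro h
  have h1 := derivative_antiderivative (crossLogDeriv p w.val)
  rw [show antiderivative (crossLogDeriv p w.val) = 0 from h, map_zero] at h1
  obtain ⟨δ, u, hδ, hu, h2⟩ := exists_crossLogDeriv_eq hp (w.2.le_ofDigits hp)
  change crossLogDeriv p w.val = _ at h2
  rw [← h1] at h2
  have hδ0 : δ ≠ 0 := fun h => w.2.ofDigits_mod_ne hp (hδ.1 h)
  refine mul_ne_zero (mul_ne_zero ?_ (pow_ne_zero _ X_ne_zero)) ?_ h2.symm
  · rwa [Ne, map_eq_zero_iff _ C_injective]
  · rintro rfl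
    exact hu (map_zero _)

theorem coeffwise_pderiv_potential (hp : p.Prime) (w : AdmissibleWord p) :
    coeffwise (MvPolynomial.pderiv w) (potential hp) =
      PowerSeries.map MvPolynomial.C (crossLogDeriv p w.val) := by
  classical
  ext1 j
  rw [coeffwise, coeff_mk, potential, coeff_mk, coeff_map, map_sum]
  simp only [MvPolynomial.pderiv_C_mul, MvPolynomial.pderiv_X, Pi.single_apply, mul_ite, mul_one,
    mul_zero, Finset.sum_ite_eq']
  split_ifs with h
  · rfl
  · rw [coeff_crossLogDeriv_eq_zero hp (not_lt.1 (mt (mem_shortWords hp).2 h)), map_zero]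

theorem exists_coeffSeries_ratioSeries (hp : p.Prime) (m : AdmissibleWord p →₀ ℕ) :
    ∃ r : ℚ, r ≠ 0 ∧
      coeffSeries m (ratioSeries hp) = C r * m.prod (fun w k => w.logSeries ^ k) := by
  obtain ⟨r, hr, h⟩ := exists_coeffSeries_eq (E := ratioSeries hp) (c := logSeries) (fun w => by
    refine coeffwise_odeSolution _ ?_ ?_
    · rw [derivative_map, coeffwise_pderiv_potential, logSeries, derivative_antiderivative]
    · rw [← coeff_zero_eq_constantCoeff_apply, coeff_map, coeff_zero_eq_constantCoeff_apply,
        logSeries, constantCoeff_antiderivative, map_zero]) m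
  refine ⟨r, hr, ?_⟩
  rw [h]
  -- Setting every `X_w` to `0` kills `potential`, so the equation becomes `F' = 0`.
  suffices coeffSeries 0 (ratioSeries hp) = 1 by rw [this, mul_one]
  have h0 : coeffSeries 0 (ratioSeries hp) =
      PowerSeries.map MvPolynomial.constantCoeff (ratioSeries hp) := by
    ext j
    simp [coeffSeries, MvPolynomial.constantCoeff_eq]
  rw [h0]
  refine eq_of_derivative_eq_mul (G := 0) ?_ ?_ ?_
  · rw [derivative_map, ratioSeries, derivative_odeSolution, map_mul]
    congr 1
    ext j
    simp [potential]
  · rw [derivative_one, zero_mul]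
  · rw [map_one, ← coeff_zero_eq_constantCoeff_apply, coeff_map, coeff_zero_eq_constantCoeff_apply,
      ratioSeries, constantCoeff_odeSolution, map_one]

end AdmissibleWord

/-! ### Taylor series of logarithms of polynomials, and growth at infinity -/

section Taylor

open PowerSeries Filter Topology

/-- The Taylor series at `0` of a real function. -/
noncomputable def taylorSeries (f : ℝ → ℝ) : ℝ⟦X⟧ :=
  PowerSeries.mk fun n => iteratedDeriv n f 0 / n.factorial

theorem taylorSeries_congr {f g : ℝ → ℝ} (h : f =ᶠ[𝓝 0] g) : taylorSeries f = taylorSeries g := by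
  ext n
  rw [taylorSeries, taylorSeries, coeff_mk, coeff_mk, h.iteratedDeriv_eq]

theorem taylorSeries_mul {f g : ℝ → ℝ} (hf : AnalyticAt ℝ f 0) (hg : AnalyticAt ℝ g 0) :
    taylorSeries (fun x => f x * g x) = taylorSeries f * taylorSeries g := by
  ext n
  simp only [taylorSeries, coeff_mk, iteratedDeriv_fun_mul hf.contDiffAt hg.contDiffAt,
    Finset.sum_div, PowerSeries.coeff_mul, Finset.Nat.sum_antidiagonal_eq_sum_range_succ_mk]
  refine Finset.sum_congr rfl fun i hi => ?_
  rw [Nat.cast_choose _ (by have := Finset.mem_range.1 hi; omega)]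
  field_simp [Nat.factorial_ne_zero]

theorem taylorSeries_sub {f g : ℝ → ℝ} (hf : AnalyticAt ℝ f 0) (hg : AnalyticAt ℝ g 0) :
    taylorSeries (fun x => f x - g x) = taylorSeries f - taylorSeries g := by
  ext n
  simp only [taylorSeries, coeff_mk, iteratedDeriv_fun_sub hf.contDiffAt hg.contDiffAt, map_sub,
    sub_div]

theorem constantCoeff_taylorSeries (f : ℝ → ℝ) : constantCoeff (taylorSeries f) = f 0 := by
  rw [← coeff_zero_eq_constantCoeff_apply, taylorSeries, coeff_mk]
  simp

theorem taylorSeries_deriv (f : ℝ → ℝ) :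
    taylorSeries (deriv f) = derivative ℝ (taylorSeries f) := by
  ext n
  rw [coeff_derivative, taylorSeries, taylorSeries, coeff_mk, coeff_mk, iteratedDeriv_succ',
    Nat.factorial_succ]
  push_cast
  field_simp

theorem analyticAt_aeval (A : Polynomial ℚ) (x : ℝ) :
    AnalyticAt ℝ (fun x : ℝ => Polynomial.aeval x A) x :=
  analyticAt_id.aeval_polynomial A

theorem iteratedDeriv_aeval (n : ℕ) (A : Polynomial ℚ) :
    iteratedDeriv n (fun x : ℝ => Polynomial.aeval x A) =
      fun x : ℝ => Polynomial.aeval x (Polynomial.derivative^[n] A) := by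
  induction n generalizing A with
  | zero => simp
  | succ n ih =>
    rw [iteratedDeriv_succ', Function.iterate_succ_apply, ← ih]
    congr 1
    ext x
    exact Polynomial.deriv_aeval A

theorem taylorSeries_aeval (A : Polynomial ℚ) :
    taylorSeries (fun x : ℝ => Polynomial.aeval x A) =
      PowerSeries.map (algebraMap ℚ ℝ) (A : ℚ⟦X⟧) := by
  ext n
  rw [taylorSeries, coeff_mk, iteratedDeriv_aeval, coeff_map, Polynomial.coeff_coe]
  beta_reduce
  rw [← Polynomial.coeff_zero_eq_aeval_zero', Polynomial.coeff_iterate_derivative, zero_add,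
    Nat.descFactorial_self, nsmul_eq_mul, map_mul, map_natCast]
  field_simp [Nat.factorial_ne_zero]

theorem taylorSeries_pow {f : ℝ → ℝ} (hf : AnalyticAt ℝ f 0) (k : ℕ) :
    taylorSeries (fun x => f x ^ k) = taylorSeries f ^ k := by
  induction k with
  | zero => simpa using taylorSeries_aeval 1
  | succ k ih => simp only [pow_succ, taylorSeries_mul (hf.fun_pow k) hf, ih]

theorem taylorSeries_prod {ι : Type*} (s : Finset ι) {f : ι → ℝ → ℝ}
    (hf : ∀ i, AnalyticAt ℝ (f i) 0) :
    taylorSeries (fun x => ∏ i ∈ s, f i x) = ∏ i ∈ s, taylorSeries (f i) := by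
  classical
  induction s using Finset.induction_on with
  | empty => simpa using taylorSeries_aeval 1
  | insert i s hi ih =>
    simp only [Finset.prod_insert hi]
    rw [taylorSeries_mul (hf i) (Finset.analyticAt_fun_prod _ fun j _ => hf j), ih]

theorem eventuallyEq_of_taylorSeries_eq {f g : ℝ → ℝ} (hf : AnalyticAt ℝ f 0)
    (hg : AnalyticAt ℝ g 0) (h : taylorSeries f = taylorSeries g) : f =ᶠ[𝓝 0] g := by
  have h1 := (hf.sub hg).hasFPowerSeriesAt
  have h2 : (fun n : ℕ => iteratedDeriv n (f - g) 0 / n.factorial) = 0 := by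
    ext n
    have h3 : taylorSeries (fun x => f x - g x) = 0 := by
      rw [taylorSeries_sub hf hg, h, sub_self]
    have h4 := congrArg (coeff n) h3
    rwa [taylorSeries, coeff_mk] at h4
  rw [h2, FormalMultilinearSeries.ofScalars_series_eq_zero_of_scalar_zero] at h1
  filter_upwards [h1.eventually_eq_zero] with x hx
  exact sub_eq_zero.1 hx

/-- A series `c` with `c' = A' / A - B' / B` is the Taylor series of `log A - log B`. -/
theorem taylorSeries_log_sub_log {A B : Polynomial ℚ} {c : ℚ⟦X⟧}
    (hA : 0 < Polynomial.aeval (0 : ℝ) A) (hB : 0 < Polynomial.aeval (0 : ℝ) B)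
    (hAB : Polynomial.aeval (0 : ℝ) A = Polynomial.aeval (0 : ℝ) B) (hc : constantCoeff c = 0)
    (h : derivative ℚ c * ((A : ℚ⟦X⟧) * (B : ℚ⟦X⟧)) =
      derivative ℚ (A : ℚ⟦X⟧) * (B : ℚ⟦X⟧) - (A : ℚ⟦X⟧) * derivative ℚ (B : ℚ⟦X⟧)) :
    taylorSeries (fun x => Real.log (Polynomial.aeval x A) - Real.log (Polynomial.aeval x B)) =
      PowerSeries.map (algebraMap ℚ ℝ) c := by
  have hlA := (analyticAt_aeval A 0).log hA
  have hlB := (analyticAt_aeval B 0).log hB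
  set f : ℝ → ℝ := fun x => Real.log (Polynomial.aeval x A) - Real.log (Polynomial.aeval x B)
    with hfdef
  have hf : AnalyticAt ℝ f 0 := hlA.fun_sub hlB
  have hode : (fun x => deriv f x * (Polynomial.aeval x A * Polynomial.aeval x B)) =ᶠ[𝓝 0]
      fun x => Polynomial.aeval x (Polynomial.derivative A * B - A * Polynomial.derivative B) := by
    filter_upwards [(analyticAt_aeval A 0).continuousAt.eventually (lt_mem_nhds hA),
      (analyticAt_aeval B 0).continuousAt.eventually (lt_mem_nhds hB)] with x hxA hxB
    have hd : HasDerivAt f _ x := ((A.hasDerivAt_aeval x).log hxA.ne').sub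
      ((B.hasDerivAt_aeval x).log hxB.ne')
    rw [hd.deriv]
    simp only [map_sub, map_mul]
    field_simp
  have h1 := taylorSeries_congr hode
  rw [taylorSeries_mul hf.deriv ((analyticAt_aeval A 0).fun_mul (analyticAt_aeval B 0)),
    taylorSeries_mul (analyticAt_aeval A 0) (analyticAt_aeval B 0), taylorSeries_aeval,
    taylorSeries_aeval, taylorSeries_aeval, taylorSeries_deriv, Polynomial.coe_sub,
    Polynomial.coe_mul, Polynomial.coe_mul, ← derivative_coe, ← derivative_coe, ← h, map_mul,
    map_mul, ← derivative_map] at h1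
  have hne : ∀ D : Polynomial ℚ, 0 < Polynomial.aeval (0 : ℝ) D →
      PowerSeries.map (algebraMap ℚ ℝ) (D : ℚ⟦X⟧) ≠ 0 := by
    intro D hD h0
    have := congrArg constantCoeff h0
    rw [← taylorSeries_aeval, constantCoeff_taylorSeries, map_zero] at this
    exact hD.ne' this
  refine derivative.ext (mul_right_cancel₀ (mul_ne_zero (hne A hA) (hne B hB)) h1) ?_
  rw [constantCoeff_taylorSeries, ← coeff_zero_eq_constantCoeff_apply, coeff_map,
    coeff_zero_eq_constantCoeff_apply, hc, map_zero, hfdef]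
  simp only [hAB, sub_self]

theorem log_aeval_isBigO_log {A : Polynomial ℚ}
    (hA : ∀ x : ℝ, 0 ≤ x → 1 ≤ Polynomial.aeval x A) :
    (fun x : ℝ => Real.log (Polynomial.aeval x A)) =O[atTop] Real.log := by
  have hlim := Polynomial.div_tendsto_atTop_zero_of_degree_lt (A.map (algebraMap ℚ ℝ))
    (Polynomial.X ^ (A.natDegree + 1)) (by
      rw [Polynomial.degree_X_pow]
      refine Polynomial.degree_map_le.trans_lt (Polynomial.degree_le_natDegree.trans_lt ?_)
      exact_mod_cast A.natDegree.lt_succ_self)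
  refine Asymptotics.IsBigO.of_bound ((A.natDegree + 1 : ℕ) : ℝ) ?_
  filter_upwards [hlim.eventually (gt_mem_nhds one_pos), eventually_ge_atTop 1] with x hx hx1
  have h1 := hA x (by linarith)
  have hpos : 0 < x ^ (A.natDegree + 1) := by positivity
  rw [Polynomial.eval_pow, Polynomial.eval_X, div_lt_one hpos, Polynomial.eval_map_algebraMap] at hx
  rw [Real.norm_of_nonneg (Real.log_nonneg h1), Real.norm_of_nonneg (Real.log_nonneg hx1),
    ← Real.log_pow]
  exact Real.log_le_log (by linarith) hx.le

/-- A polynomial that agrees on `[0, ∞)` with a function of logarithmic growth is constant. -/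
theorem natDegree_eq_zero_of_isBigO_log_pow {g : Polynomial ℚ} {K : ℕ}
    (h : (fun x : ℝ => Polynomial.aeval x g) =O[atTop] fun x => Real.log x ^ K) :
    g.natDegree = 0 := by
  have h1 := (h.trans_isLittleO Real.isLittleO_pow_log_id_atTop).tendsto_div_nhds_zero
  have h2 := (Polynomial.div_tendsto_atTop_zero_iff_degree_lt (g.map (algebraMap ℚ ℝ))
    Polynomial.X Polynomial.X_ne_zero).1 (by simpa using h1)
  rw [Polynomial.degree_X, Polynomial.degree_map] at h2
  by_contra hne
  have := Polynomial.natDegree_lt_natDegree_iff (p := g) (q := Polynomial.X)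
    (by rintro rfl; simp at hne)
  rw [Polynomial.degree_X, Polynomial.natDegree_X] at this
  have := this.2 h2
  omega

end Taylor

/-! ### Products of the series `log r_w` are not polynomials -/

theorem one_le_aeval_carryPoly (p n : ℕ) {x : ℝ} (hx : 0 ≤ x) :
    1 ≤ Polynomial.aeval x (carryPoly p n) := by
  rw [carryPoly, map_sum]
  simp only [map_pow, Polynomial.aeval_X]
  calc (1 : ℝ) = x ^ factorialExponent p n 0 (n - 0) := by simp [factorialExponent]
    _ ≤ _ := Finset.single_le_sum (f := fun t => x ^ factorialExponent p n t (n - t))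
      (fun t _ => by positivity) (by simp)

theorem one_le_aeval_crossNum (p n : ℕ) {x : ℝ} (hx : 0 ≤ x) :
    1 ≤ Polynomial.aeval x (crossNum p n) := by
  rw [crossNum, map_mul]
  exact one_le_mul_of_one_le_of_one_le (one_le_aeval_carryPoly _ _ hx)
    (one_le_aeval_carryPoly _ _ hx)

theorem one_le_aeval_crossDen (p n : ℕ) {x : ℝ} (hx : 0 ≤ x) :
    1 ≤ Polynomial.aeval x (crossDen p n) := by
  rw [crossDen, map_mul]
  exact one_le_mul_of_one_le_of_one_le (one_le_aeval_carryPoly _ _ hx)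
    (one_le_aeval_carryPoly _ _ hx)

namespace AdmissibleWord

open PowerSeries Filter Topology

variable {p : ℕ}

/-- The real function `log r_w` whose Taylor series is `logSeries w`. -/
noncomputable def logFun (w : AdmissibleWord p) (x : ℝ) : ℝ :=
  Real.log (Polynomial.aeval x (crossNum p w.val)) -
    Real.log (Polynomial.aeval x (crossDen p w.val))

theorem analyticAt_logFun (w : AdmissibleWord p) {x : ℝ} (hx : 0 ≤ x) :
    AnalyticAt ℝ w.logFun x :=
  ((analyticAt_aeval _ x).log (one_pos.trans_le (one_le_aeval_crossNum _ _ hx))).fun_sub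
    ((analyticAt_aeval _ x).log (one_pos.trans_le (one_le_aeval_crossDen _ _ hx)))

theorem taylorSeries_logFun (hp : p.Prime) (w : AdmissibleWord p) :
    taylorSeries w.logFun = PowerSeries.map (algebraMap ℚ ℝ) w.logSeries := by
  refine taylorSeries_log_sub_log (one_pos.trans_le (one_le_aeval_crossNum _ _ le_rfl))
    (one_pos.trans_le (one_le_aeval_crossDen _ _ le_rfl)) ?_ (constantCoeff_antiderivative _) ?_
  · obtain ⟨δ, -, h⟩ := exists_crossNum_sub_crossDen hp (w.2.le_ofDigits hp)
    have h1 := congrArg (Polynomial.aeval (0 : ℝ)) h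
    rw [map_sub] at h1
    refine sub_eq_zero.1 (h1.trans ?_)
    simp
  · rw [logSeries, derivative_antiderivative, crossLogDeriv_mul hp]

theorem logFun_isBigO (w : AdmissibleWord p) : w.logFun =O[atTop] Real.log :=
  (log_aeval_isBigO_log fun _ hx => one_le_aeval_crossNum _ _ hx).sub
    (log_aeval_isBigO_log fun _ hx => one_le_aeval_crossDen _ _ hx)

/-- A nontrivial product of the series `log r_w` is not a polynomial. -/
theorem prod_logSeries_ne_polynomial (hp : p.Prime) {m : AdmissibleWord p →₀ ℕ} (hm : m ≠ 0)
    (g : Polynomial ℚ) : m.prod (fun w k => w.logSeries ^ k) ≠ (g : ℚ⟦X⟧) := by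
  intro h
  have hpow : ∀ x : ℝ, 0 ≤ x → ∀ w : AdmissibleWord p,
      AnalyticAt ℝ (fun x => w.logFun x ^ m w) x := fun x hx w =>
    (w.analyticAt_logFun hx).fun_pow _
  have hF : AnalyticOnNhd ℝ (fun x => ∏ w ∈ m.support, w.logFun x ^ m w) (Set.Ici 0) :=
    fun x hx => Finset.analyticAt_fun_prod _ fun w _ => hpow x hx w
  have htaylor : taylorSeries (fun x => ∏ w ∈ m.support, w.logFun x ^ m w) =
      taylorSeries (fun x : ℝ => Polynomial.aeval x g) := by
    rw [taylorSeries_prod _ (hpow 0 le_rfl), taylorSeries_aeval, ← h, Finsupp.prod, map_prod]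
    refine Finset.prod_congr rfl fun w _ => ?_
    rw [taylorSeries_pow (w.analyticAt_logFun le_rfl), taylorSeries_logFun hp, map_pow]
  -- Identity theorem on the connected set `[0, ∞)`: equality of Taylor series at `0` carries to
  -- infinity.
  have heq := hF.eqOn_of_preconnected_of_eventuallyEq (fun x _ => analyticAt_aeval g x)
    (convex_Ici 0).isPreconnected (Set.self_mem_Ici)
    (eventuallyEq_of_taylorSeries_eq (hF 0 Set.self_mem_Ici) (analyticAt_aeval g 0) htaylor)
  have hgrowth : (fun x : ℝ => Polynomial.aeval x g) =O[atTop]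
      fun x => Real.log x ^ ∑ w ∈ m.support, m w := by
    refine Asymptotics.IsBigO.congr' (f₁ := fun x => ∏ w ∈ m.support, w.logFun x ^ m w)
      (g₁ := fun x => ∏ w ∈ m.support, Real.log x ^ m w)
      (Asymptotics.IsBigO.finsetProd fun w _ => (w.logFun_isBigO).pow _) ?_ ?_
    · filter_upwards [eventually_ge_atTop 0] with x hx using heq hx
    · exact Eventually.of_forall fun x => Finset.prod_pow_eq_pow_sum ..
  obtain ⟨w, hw⟩ := Finsupp.support_nonempty_iff.2 hm
  have hconst : constantCoeff (m.prod fun w k => w.logSeries ^ k) = 0 := by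
    rw [Finsupp.prod, map_prod]
    refine Finset.prod_eq_zero hw ?_
    rw [map_pow, logSeries, constantCoeff_antiderivative, zero_pow (Finsupp.mem_support_iff.1 hw)]
  have hg := Polynomial.eq_C_of_natDegree_eq_zero (natDegree_eq_zero_of_isBigO_log_pow hgrowth)
  have hzero : m.prod (fun w k => w.logSeries ^ k) = 0 := by
    rw [h, ← coeff_zero_eq_constantCoeff_apply, Polynomial.coeff_coe] at hconst
    rw [h, hg, hconst]
    simp
  obtain ⟨v, -, hv⟩ := Finset.prod_eq_zero_iff.1 hzero
  exact v.logSeries_ne_zero hp ((pow_eq_zero_iff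
    (by rintro h0; simp [h0] at hv)).1 hv)

end AdmissibleWord

theorem mainTheorem7 (p : ℕ) (hp : p.Prime) :
    ∃ P : ℕ → MvPolynomial (AdmissibleWord p) ℚ,
      (∀ (j : ℕ) (Q : MvPolynomial (AdmissibleWord p) ℚ), RepresentsRatio p j Q ↔ Q = P j) ∧
      ∀ m : AdmissibleWord p →₀ ℕ, m ≠ 0 →
        {j : ℕ | MvPolynomial.coeff m (P j) ≠ 0}.Infinite := by
  refine ⟨fun j => PowerSeries.coeff j (AdmissibleWord.ratioSeries hp),
    AdmissibleWord.representsRatio_iff hp, fun m hm hfin => ?_⟩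
  obtain ⟨r, hr, h⟩ := AdmissibleWord.exists_coeffSeries_ratioSeries hp m
  obtain ⟨N, hN⟩ := hfin.bddAbove
  -- If no index beyond `N` contributes, the coefficient series equals its truncation, and dividing
  -- by `r` makes the product of logarithms a polynomial.
  refine AdmissibleWord.prod_logSeries_ne_polynomial hp hm
    (Polynomial.C r⁻¹ * PowerSeries.trunc (N + 1) (coeffSeries m (AdmissibleWord.ratioSeries hp))) ?_
  have htrunc : (PowerSeries.trunc (N + 1) (coeffSeries m (AdmissibleWord.ratioSeries hp)) :
      PowerSeries ℚ) = coeffSeries m (AdmissibleWord.ratioSeries hp) := by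
    ext j
    rw [Polynomial.coeff_coe, PowerSeries.coeff_trunc]
    split_ifs with hj
    · rfl
    · rw [coeffSeries, PowerSeries.coeff_mk]
      by_contra hne
      exact hj (Nat.lt_succ_of_le (hN (Ne.symm hne)))
  rw [Polynomial.coe_mul, Polynomial.coe_C, htrunc, h, ← mul_assoc, ← map_mul,
    inv_mul_cancel₀ hr, map_one, one_mul]
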